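/- Let $M\ge 2$, $a>0$, $\mu\in\mathbb R$, $g_0,\dots,g_{M-1}\in\mathbb R\setminus\{0\}$, and let $\theta_0,\dots,\theta_{M-1}\in[0,2\pi)$ be pairwise distinct. For $0\le m\le M-1$ consider the logarithmic spiral $$\Sigma_m=\{Z_m(\theta):\theta\in\mathbb R\}\subset\mathbb C=\mathbb R^2,\qquad Z_m(\theta)=e^{a(\theta-\theta_m)}e^{i\theta},$$ with unit tangent vector $\vec\tau=Z_m'/|Z_m'|$, unit normal vector $\vec n=-i\vec\tau$, and density $\gamma_m:\Sigma_m\to\mathbb R$ given by $$\gamma_m(Z_m(\theta))=\frac{\partial_\theta\left(g_me^{2a(\theta-\theta_m)}\right)}{|Z_m'(\theta)|}=\frac{2ag_m}{\sqrt{1+a^2}}\,e^{a(\theta-\theta_m)},\qquad \theta\in\mathbb R.$$ Let $\delta_{\Sigma_m}$ be the arc-length measure on $\Sigma_m$ and let $\mathcal R_F=\mathbb C\setminus(\Sigma_0\cup\dots\cup\Sigma_{M-1}\cup\{0\})$. Then there is, up to equality almost everywhere, at most one locally integrable vector field $w:\mathbb R^2\to\mathbb R^2$ such that 1. $\operatorname{div}w=0$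 and $\operatorname{curl}w=\partial_1w_2-\partial_2w_1=\sum_{k=0}^{M-1}\gamma_k\,\delta_{\Sigma_k}$ in the sense of distributions on $\mathbb R^2$; 2. (velocity matching) $\vec n(z)\cdot(w(z)-\mu z)=0$ for all $z\in\Sigma_m$ and $0\le m\le M-1$, where $\vec n(z)\cdot w(z)$ denotes the common limit of $\vec n(z)\cdot w(z')$ as $z'\to z$, $z'\in\mathcal R_F$, from both sides of the spiral; 3. (decay) $|w(z)|\le C|z|$ for some constant $C$ and all $z\in\mathcal R_F$ near $0$. Here the limit in 2 and the bound in 3 are understood up to Lebesgue null sets. In particular, two such fields that are continuous on $\mathcal R_F$ coincide at every point of $\mathcal R_F$. -/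

import Mathlib

open scoped Topology ContDiff

noncomputable section

namespace LogSpirals

/-! The plane is identified with `ℂ`; the Euclidean scalar product of two plane vectors
is `inner ℝ u v`, the real part of `conj u * v`. -/

/-- Parametrization of the logarithmic spiral with growth rate `a` and shift `θ₀`:
`θ ↦ exp (a (θ - θ₀)) exp (i θ)`. -/
def Z (a θ₀ θ : ℝ) : ℂ :=
  (Real.exp (a * (θ - θ₀)) : ℂ) * Complex.exp ((θ : ℂ) * Complex.I)

/-- The spiral as a subset of the plane. -/
def spiral (a θ₀ : ℝ) : Set ℂ := Set.range (Z a θ₀)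

/-- The circulation function along the spiral. -/
def circulation (a g θ₀ θ : ℝ) : ℝ := g * Real.exp (2 * a * (θ - θ₀))

/-- The density of vorticity with respect to arc length, at the point `Z a θ₀ θ`:
derivative of the circulation divided by the speed of the parametrization. -/
def density (a g θ₀ θ : ℝ) : ℝ :=
  deriv (circulation a g θ₀) θ / ‖deriv (Z a θ₀) θ‖

/-- The unit tangent vector of the spiral at `Z a θ₀ θ`. -/
def tangent (a θ₀ θ : ℝ) : ℂ :=
  deriv (Z a θ₀) θ / (‖deriv (Z a θ₀) θ‖ : ℂ)

/-- The unit normal vector `n = - i τ` of the spiral at `Z a θ₀ θ`. -/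
def normal (a θ₀ θ : ℝ) : ℂ := -Complex.I * tangent a θ₀ θ

/-- The complement of the union of all the spirals and of the origin. -/
def complementSet {M : ℕ} (a : ℝ) (θs : Fin M → ℝ) : Set ℂ :=
  ((⋃ m, spiral a (θs m)) ∪ {0})ᶜ

/-- Smooth compactly supported real test functions on the plane. -/
def IsTestFunction (φ : ℂ → ℝ) : Prop := ContDiff ℝ ∞ φ ∧ HasCompactSupport φ

/-- Partial derivative in the direction of the first coordinate axis. -/
def pdx (φ : ℂ → ℝ) (z : ℂ) : ℝ := fderiv ℝ φ z 1

/-- Partial derivative in the direction of the second coordinate axis. -/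
def pdy (φ : ℂ → ℝ) (z : ℂ) : ℝ := fderiv ℝ φ z Complex.I

/-- The distribution `div w`, for `w = w₁ + i w₂` locally integrable: minus the integral
of `w₁ ∂₁φ + w₂ ∂₂φ`. -/
def distDiv (w : ℂ → ℂ) (φ : ℂ → ℝ) : ℝ :=
  -∫ z : ℂ, ((w z).re * pdx φ z + (w z).im * pdy φ z)

/-- The distribution `curl w = ∂₁w₂ - ∂₂w₁`, for `w = w₁ + i w₂` locally integrable:
minus the integral of `w₂ ∂₁φ - w₁ ∂₂φ`. -/
def distCurl (w : ℂ → ℂ) (φ : ℂ → ℝ) : ℝ :=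
  -∫ z : ℂ, ((w z).im * pdx φ z - (w z).re * pdy φ z)

/-- The distribution `γ δ_Σ`: integration over the spiral against the density `γ` times
arc length. -/
def sheet (a g θ₀ : ℝ) (φ : ℂ → ℝ) : ℝ :=
  ∫ θ : ℝ, φ (Z a θ₀ θ) * density a g θ₀ θ * ‖deriv (Z a θ₀) θ‖

/-- `z' → z` with `z'` off the spirals and the origin, ignoring Lebesgue null sets (a locally
integrable field is only defined up to such a set; for a field that is continuous off the spirals
this is ordinary convergence). Near a point of a spiral, being off the spirals means being on its
left or on its right side. -/
def offSpirals {M : ℕ} (a : ℝ) (θs : Fin M → ℝ) (z : ℂ) : Filter ℂ :=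
  𝓝[complementSet a θs] z ⊓ MeasureTheory.ae MeasureTheory.volume

/-- Locally integrable, weakly divergence-free fields whose curl is the sum of the vortex sheets,
which satisfy the velocity matching condition on every spiral and decay at least linearly at `0`. -/
structure IsSpiralVelocity {M : ℕ} (a μ : ℝ) (g θs : Fin M → ℝ) (w : ℂ → ℂ) : Prop where
  locallyIntegrable : MeasureTheory.LocallyIntegrable w
  div_eq : ∀ φ, IsTestFunction φ → distDiv w φ = 0
  curl_eq : ∀ φ, IsTestFunction φ → distCurl w φ = ∑ k, sheet a (g k) (θs k) φ
  /-- `n(z) · (w(z) - μ z) = 0` on every spiral, where `n(z) · w(z)` is the common limit of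
  the normal component from both sides. -/
  velocity_matching : ∀ (m : Fin M) (θ : ℝ),
    Filter.Tendsto (fun z => inner ℝ (normal a (θs m) θ) (w z - (μ : ℂ) * z))
      (offSpirals a θs (Z a (θs m) θ)) (𝓝 0)
  decay : w =O[offSpirals a θs 0] (fun z => z)

theorem hasDerivAt_Z (a θ₀ θ : ℝ) :
    HasDerivAt (Z a θ₀) (((a : ℂ) + Complex.I) * Z a θ₀ θ) θ := by
  have h1 : HasDerivAt (fun t : ℝ => Real.exp (a * (t - θ₀)))
      (Real.exp (a * (θ - θ₀)) * (a * 1)) θ :=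
    (((hasDerivAt_id θ).sub_const θ₀).const_mul a).exp
  have h2 : HasDerivAt (fun t : ℝ => Complex.exp ((t : ℂ) * Complex.I))
      (Complex.exp ((θ : ℂ) * Complex.I) * (1 * Complex.I)) θ :=
    ((hasDerivAt_id θ).ofReal_comp.mul_const Complex.I).cexp
  have h := h1.ofReal_comp.mul h2
  refine h.congr_deriv ?_
  simp only [Z]
  push_cast
  ring

end LogSpirals

end

/-! In the difference `w₁ - w₂` the vortex sheets and the term `μ z` cancel, so it is weakly
divergence- and curl-free. By Weyl's lemma (`exists_entire_ae_eq_conj`) it is almost everywhere the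
conjugate of an entire `h`. Velocity matching on a single spiral then says that `F z = (a + i) z h
z` is real along that spiral, and `F 0 = 0`. If `F` were nonzero, its leading term `c zⁿ` at `0`,
with `n ≥ 1`, would take every argument as the spiral winds into the origin, contradicting realness
(`eq_zero_of_real_on_spiral`). Hence `h = 0`. -/

namespace LogSpirals

open MeasureTheory Filter Convolution

/-! ### Weyl's lemma for divergence- and curl-free fields -/

/-- There is a radial test function of mass one on the plane. -/
theorem exists_radial_bump : ∃ ψ : ℂ → ℝ, ContDiff ℝ ∞ ψ ∧ HasCompactSupport ψ ∧
    (∀ c z : ℂ, ‖c‖ = 1 → ψ (c * z) = ψ z) ∧ ∫ z, ψ z = 1 := by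
  let b : ContDiffBump (0 : ℝ) := ⟨1, 2, one_pos, one_lt_two⟩
  let ψ : ℂ → ℝ := fun z => b (Complex.normSq z)
  have hn : ContDiff ℝ ∞ (fun z : ℂ => Complex.normSq z) := by
    simp only [Complex.normSq_apply]
    have h1 : ContDiff ℝ ∞ (fun z : ℂ => z.re) := Complex.reCLM.contDiff
    have h2 : ContDiff ℝ ∞ (fun z : ℂ => z.im) := Complex.imCLM.contDiff
    fun_prop
  have hψ : ContDiff ℝ ∞ ψ := b.contDiff.comp hn
  have hs : HasCompactSupport ψ := by
    refine HasCompactSupport.intro (isCompact_closedBall (0 : ℂ) 2) fun z hz => ?_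
    have hz' : 2 < ‖z‖ := by simpa using hz
    apply b.zero_of_le_dist
    have : (2 : ℝ) ≤ Complex.normSq z := by
      rw [Complex.normSq_eq_norm_sq]; nlinarith
    simpa [Real.dist_eq, abs_of_nonneg (Complex.normSq_nonneg z)] using this
  have hpos : 0 < ∫ z, ψ z := by
    refine hψ.continuous.integral_pos_of_hasCompactSupport_nonneg_nonzero hs
      (fun z => b.nonneg) (x := 0) ?_
    have : b 0 = 1 := b.one_of_mem_closedBall (by simp [b])
    simp [ψ, this]
  refine ⟨fun z => (∫ z, ψ z)⁻¹ * ψ z, contDiff_const.mul hψ, hs.mul_left, ?_, ?_⟩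
  · intro c z hc
    simp [ψ, Complex.normSq_eq_norm_sq, hc]
  · rw [integral_const_mul, inv_mul_cancel₀ hpos.ne']

/-- Averaging an entire function against a radial kernel of mass one reproduces it. -/
theorem radial_convolution_eq {ψ : ℂ → ℝ} (hψ : Continuous ψ) (hs : HasCompactSupport ψ)
    (hr : ∀ c z : ℂ, ‖c‖ = 1 → ψ (c * z) = ψ z) (h1 : ∫ z, ψ z = 1)
    {h : ℂ → ℂ} (hh : Differentiable ℂ h) (z : ℂ) :
    (ψ ⋆[ContinuousLinearMap.lsmul ℝ ℝ, volume] h) z = h z := by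
  -- The substitution `t ↦ -exp (i θ) t` preserves `ψ` and Lebesgue measure. Averaging over `θ` and
  -- swapping integrals leaves circle means of `h`.
  have hrot : ∀ θ : ℝ, ∫ t, ψ t • h (z - t) =
      ∫ t, ψ t • h (z + Complex.exp (θ * Complex.I) * t) := by
    intro θ
    have hc : ‖-Complex.exp (θ * Complex.I)‖ = 1 := by
      rw [norm_neg, Complex.norm_exp_ofReal_mul_I]
    let c : Circle := ⟨-Complex.exp (θ * Complex.I), by simp [Submonoid.unitSphere]⟩
    have := (rotation c).measurePreserving.integral_comp
      (rotation c).toHomeomorph.measurableEmbedding (fun t => ψ t • h (z - t))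
    rw [← this]
    refine integral_congr_ae (Eventually.of_forall fun t => ?_)
    have e : rotation c t = -Complex.exp (θ * Complex.I) * t := rotation_apply c t
    simp only [e, hr _ t hc]
    congr 2
    ring
  have hint : Integrable (Function.uncurry fun (θ : ℝ) (t : ℂ) =>
      ψ t • h (z + Complex.exp (θ * Complex.I) * t))
      ((volume.restrict (Set.uIoc 0 (2 * Real.pi))).prod volume) := by
    have hcont : Continuous (Function.uncurry fun (θ : ℝ) (t : ℂ) =>
        ψ t • h (z + Complex.exp (θ * Complex.I) * t)) := by
      have := hh.continuous
      unfold Function.uncurry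
      fun_prop
    have hon : IntegrableOn (Function.uncurry fun (θ : ℝ) (t : ℂ) =>
        ψ t • h (z + Complex.exp (θ * Complex.I) * t))
        (Set.uIcc 0 (2 * Real.pi) ×ˢ tsupport ψ) (volume.prod volume) :=
      hcont.continuousOn.integrableOn_compact (isCompact_uIcc.prod hs)
    have hon2 : IntegrableOn (Function.uncurry fun (θ : ℝ) (t : ℂ) =>
        ψ t • h (z + Complex.exp (θ * Complex.I) * t))
        (Set.uIoc 0 (2 * Real.pi) ×ˢ Set.univ) (volume.prod volume) := by
      refine (hon.of_forall_sdiff_eq_zero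
        (t := Set.uIcc 0 (2 * Real.pi) ×ˢ Set.univ)
        (measurableSet_uIcc.prod MeasurableSet.univ) ?_).mono_set
        (Set.prod_mono Set.uIoc_subset_uIcc subset_rfl)
      rintro ⟨θ, t⟩ ⟨hx, hnx⟩
      have : t ∉ tsupport ψ := fun ht => hnx ⟨hx.1, ht⟩
      simp [Function.uncurry, image_eq_zero_of_notMem_tsupport this]
    rw [IntegrableOn, ← Measure.prod_restrict, Measure.restrict_univ] at hon2
    exact hon2
  have hmean : ∀ t : ℂ, ∫ θ in (0 : ℝ)..2 * Real.pi,
      ψ t • h (z + Complex.exp (θ * Complex.I) * t) = (2 * Real.pi) • (ψ t • h z) := by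
    intro t
    have hc := (hh.diffContOnCl (s := Metric.ball z |‖t‖|)).circleAverage
    rw [Real.circleAverage_def] at hc
    -- In polar form the integrand is `circleMap` shifted by `t.arg`; periodicity absorbs the shift.
    have hrt : ∫ θ in (0 : ℝ)..2 * Real.pi, h (z + Complex.exp (θ * Complex.I) * t) =
        ∫ θ in (0 : ℝ)..2 * Real.pi, h (circleMap z ‖t‖ θ) := by
      have hp : Function.Periodic (fun θ => h (circleMap z ‖t‖ θ)) (2 * Real.pi) :=
        fun θ => by simp only [periodic_circleMap z ‖t‖ θ]
      have hshift := hp.intervalIntegral_add_eq (t.arg) 0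
      rw [zero_add] at hshift
      have e := intervalIntegral.integral_comp_add_left (a := 0) (b := 2 * Real.pi)
        (fun θ => h (circleMap z ‖t‖ θ)) t.arg
      rw [add_zero] at e
      rw [← hshift, ← e]
      refine intervalIntegral.integral_congr fun θ _ => ?_
      have ht : Complex.exp (θ * Complex.I) * t =
          ‖t‖ * Complex.exp ((t.arg + θ : ℝ) * Complex.I) := by
        nth_rw 1 [← Complex.norm_mul_exp_arg_mul_I t]
        rw [mul_left_comm, ← Complex.exp_add]
        push_cast
        ring_nf
      simp only [circleMap, ht]
    rw [intervalIntegral.integral_smul, hrt, ← hc]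
    rw [smul_comm (2 * Real.pi), smul_smul (2 * Real.pi), mul_inv_cancel₀ (by positivity), one_smul]
  have hfub : ∫ θ in (0 : ℝ)..2 * Real.pi, ∫ t, ψ t • h (z + Complex.exp (θ * Complex.I) * t) =
      ∫ t, ∫ θ in (0 : ℝ)..2 * Real.pi, ψ t • h (z + Complex.exp (θ * Complex.I) * t) :=
    intervalIntegral_integral_swap hint
  simp only [hmean, ← hrot, intervalIntegral.integral_const, integral_smul,
    integral_smul_const, h1, one_smul, sub_zero] at hfub
  rw [convolution_def]
  exact smul_right_injective ℂ (r := 2 * Real.pi) (by positivity) hfub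

/-- Distributional divergence- and curl-freeness give the Cauchy--Riemann equations for
convolutions of the conjugate field with test functions. -/
theorem differentiable_convolution_conj {w : ℂ → ℂ} (hw : LocallyIntegrable w)
    (hdiv : ∀ φ, IsTestFunction φ → distDiv w φ = 0)
    (hcurl : ∀ φ, IsTestFunction φ → distCurl w φ = 0)
    {ψ : ℂ → ℝ} (hψ : ContDiff ℝ ∞ ψ) (hs : HasCompactSupport ψ) :
    Differentiable ℂ (ψ ⋆[ContinuousLinearMap.lsmul ℝ ℝ, volume]
      fun z => (starRingEnd ℂ) (w z)) := by
  intro x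
  set f : ℂ → ℂ := fun z => (starRingEnd ℂ) (w z) with hf
  have hfi : LocallyIntegrable f := by
    intro y
    obtain ⟨s, hs, hi⟩ := hw y
    exact ⟨s, hs, Complex.conjCLE.toContinuousLinearMap.integrable_comp hi⟩
  have hD := hs.hasFDerivAt_convolution_left (ContinuousLinearMap.lsmul ℝ ℝ)
    (hψ.of_le (by simp)) hfi x (μ := volume)
  have hφ : IsTestFunction (fun t => ψ (x - t)) :=
    ⟨hψ.comp (contDiff_const.sub contDiff_id), hs.comp_homeomorph (Homeomorph.subLeft x)⟩
  have hψd : Differentiable ℝ ψ := hψ.differentiable (by simp)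
  have hfd : ∀ v t, fderiv ℝ (fun t => ψ (x - t)) t v = -fderiv ℝ ψ (x - t) v := by
    intro v t
    have h1 := (hψd (x - t)).hasFDerivAt.comp t ((hasFDerivAt_id (𝕜 := ℝ) t).const_sub x)
    have := h1.fderiv
    simp only [Function.comp_def] at this
    rw [this]; simp
  have hval : ∀ v, (fderiv ℝ ψ ⋆[(ContinuousLinearMap.lsmul ℝ ℝ).precompL ℂ, volume] f) x v =
      -∫ t, (fderiv ℝ (fun t => ψ (x - t)) t v) • f t := by
    intro v
    have hex := (hs.fderiv (𝕜 := ℝ)).convolutionExists_left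
      ((ContinuousLinearMap.lsmul ℝ ℝ : ℝ →L[ℝ] ℂ →L[ℝ] ℂ).precompL ℂ)
      (hψ.continuous_fderiv (by simp)) hfi x
    rw [convolution_def, ContinuousLinearMap.integral_apply hex]
    simp only [hfd, neg_smul, integral_neg, neg_neg]
    rw [← integral_sub_left_eq_self _ volume x]
    simp [ContinuousLinearMap.precompL_apply]
  have hint : ∀ v, Integrable fun t => (fderiv ℝ (fun t => ψ (x - t)) t v) • f t := by
    intro v
    refine hfi.integrable_smul_left_of_hasCompactSupport ?_ ?_
    · exact (hφ.1.continuous_fderiv (by simp)).clm_apply continuous_const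
    · exact (hφ.2.fderiv (𝕜 := ℝ)).comp_left (g := fun L : ℂ →L[ℝ] ℝ => L v) (by simp)
  have hre : ∀ v, (∫ t, (fderiv ℝ (fun t => ψ (x - t)) t v) • f t).re =
      ∫ t, (w t).re * fderiv ℝ (fun t => ψ (x - t)) t v := by
    intro v
    rw [← Complex.reCLM_apply, ← Complex.reCLM.integral_comp_comm (hint v)]
    simp [hf, mul_comm]
  have him : ∀ v, (∫ t, (fderiv ℝ (fun t => ψ (x - t)) t v) • f t).im =
      -∫ t, (w t).im * fderiv ℝ (fun t => ψ (x - t)) t v := by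
    intro v
    rw [← Complex.imCLM_apply, ← Complex.imCLM.integral_comp_comm (hint v), ← integral_neg]
    simp [hf, mul_comm]
  have hire : ∀ v, Integrable fun t => (w t).re * fderiv ℝ (fun t => ψ (x - t)) t v := by
    intro v
    have := Complex.reCLM.integrable_comp (hint v)
    simpa [hf, mul_comm] using this
  have hiim : ∀ v, Integrable fun t => (w t).im * fderiv ℝ (fun t => ψ (x - t)) t v := by
    intro v
    have := (Complex.imCLM.integrable_comp (hint v)).neg
    refine this.congr (Eventually.of_forall fun t => ?_)
    simp [hf, mul_comm]
  have hd := hdiv _ hφ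
  have hc := hcurl _ hφ
  simp only [distDiv, distCurl, pdx, pdy, neg_eq_zero] at hd hc
  rw [integral_add (hire 1) (hiim _)] at hd
  rw [integral_sub (hiim 1) (hire _)] at hc
  rw [differentiableAt_complex_iff_differentiableAt_real]
  refine ⟨hD.differentiableAt, ?_⟩
  rw [hD.fderiv, hval, hval]
  -- The real part is the curl equation, the imaginary part the divergence equation.
  apply Complex.ext
  · rw [smul_eq_mul, Complex.I_mul_re, Complex.neg_re, Complex.neg_im, hre, him]
    linarith
  · rw [smul_eq_mul, Complex.I_mul_im, Complex.neg_re, Complex.neg_im, hre, him]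
    linarith

/-- Weyl's lemma for the Cauchy--Riemann system: a locally integrable field that is weakly
divergence- and curl-free is almost everywhere the conjugate of an entire function. -/
theorem exists_entire_ae_eq_conj {w : ℂ → ℂ} (hw : LocallyIntegrable w)
    (hdiv : ∀ φ, IsTestFunction φ → distDiv w φ = 0)
    (hcurl : ∀ φ, IsTestFunction φ → distCurl w φ = 0) :
    ∃ h : ℂ → ℂ, Differentiable ℂ h ∧ ∀ᵐ z, w z = (starRingEnd ℂ) (h z) := by
  obtain ⟨ψ, hψ, hs, hr, h1⟩ := exists_radial_bump
  set f : ℂ → ℂ := fun z => (starRingEnd ℂ) (w z) with hf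
  have hfi : LocallyIntegrable f := by
    intro y
    obtain ⟨s, hs, hi⟩ := hw y
    exact ⟨s, hs, Complex.conjCLE.toContinuousLinearMap.integrable_comp hi⟩
  have hfn : LocallyIntegrable (fun z => ‖f z‖) := fun y => by
    obtain ⟨s, hs, hi⟩ := hfi y
    exact ⟨s, hs, hi.norm⟩
  have hh := differentiable_convolution_conj hw hdiv hcurl hψ hs
  -- The entire function is `ψ ⋆ f`. For mollifiers `φₙ`, `φₙ ⋆ f` is entire, so `φₙ ⋆ f = ψ ⋆ (φₙ ⋆
  -- f) = φₙ ⋆ (ψ ⋆ f)`. The left side tends to `f` almost everywhere, the right side to `ψ ⋆ f`.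
  refine ⟨_, hh, ?_⟩
  have hassoc : ∀ {α β : ℂ → ℝ}, Continuous α → HasCompactSupport α → Continuous β →
      HasCompactSupport β → ∀ x,
      ((α ⋆[ContinuousLinearMap.lsmul ℝ ℝ, volume] β)
        ⋆[ContinuousLinearMap.lsmul ℝ ℝ, volume] f) x =
      (α ⋆[ContinuousLinearMap.lsmul ℝ ℝ, volume]
        (β ⋆[ContinuousLinearMap.lsmul ℝ ℝ, volume] f)) x := by
    intro α β hα hαs hβ hβs x
    refine convolution_assoc _ _ _ _ (fun a b c => by simp [mul_assoc]) hα.aestronglyMeasurable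
      hβ.aestronglyMeasurable hfi.aestronglyMeasurable ?_ ?_ ?_
    · exact Eventually.of_forall
        (hαs.convolutionExists_left _ hα hβ.locallyIntegrable)
    · exact Eventually.of_forall
        (hβs.norm.convolutionExists_left _ hβ.norm hfn)
    · exact hαs.norm.convolutionExists_left _ hα.norm
        (hβs.norm.continuous_convolution_left _ hβ.norm hfn).locallyIntegrable x
  -- Almost everywhere convergence needs a bounded ratio of outer to inner radius; here it is `2`.
  let φ : ℕ → ContDiffBump (0 : ℂ) := fun n =>
    ⟨1 / ((n : ℝ) + 1), 2 * (1 / ((n : ℝ) + 1)), by positivity,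
      by have : 0 < 1 / ((n : ℝ) + 1) := by positivity
         linarith⟩
  have hφ : Tendsto (fun n => (φ n).rOut) atTop (𝓝 0) := by
    simpa [φ] using (tendsto_one_div_add_atTop_nhds_zero_nat (𝕜 := ℝ)).const_mul 2
  have hae := ContDiffBump.ae_convolution_tendsto_right_of_locallyIntegrable (K := 2) hφ
    (Eventually.of_forall fun n => le_rfl) hfi
  filter_upwards [hae] with z hz
  have hz' := ContDiffBump.convolution_tendsto_right_of_continuous (μ := volume) hφ hh.continuous z
  have heq : ∀ n, ((φ n).normed volume ⋆[ContinuousLinearMap.lsmul ℝ ℝ, volume] f) z =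
      ((φ n).normed volume ⋆[ContinuousLinearMap.lsmul ℝ ℝ, volume]
        (ψ ⋆[ContinuousLinearMap.lsmul ℝ ℝ, volume] f)) z := by
    intro n
    have hn : ContDiff ℝ ∞ ((φ n).normed volume) := (φ n).contDiff_normed
    have hns : HasCompactSupport ((φ n).normed volume) := (φ n).hasCompactSupport_normed
    rw [← radial_convolution_eq hψ.continuous hs hr h1
      (differentiable_convolution_conj hw hdiv hcurl hn hns) z,
      ← hassoc hψ.continuous hs hn.continuous hns, ← hassoc hn.continuous hns hψ.continuous hs]
    congr 1
    rw [← convolution_flip]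
    congr 1
    ext
    simp
  simp only [heq] at hz
  have := tendsto_nhds_unique hz hz'
  rw [← this, hf, Complex.conj_conj]

/-! ### Rigidity of entire functions real on a spiral -/

theorem Z_pow (a θ₀ θ : ℝ) (n : ℕ) :
    Z a θ₀ θ ^ n =
    ((Real.exp (a * (θ - θ₀)) ^ n : ℝ) : ℂ) * Complex.exp ((n * θ : ℝ) * Complex.I) := by
  rw [Z, mul_pow, ← Complex.exp_nat_mul]
  push_cast
  ring_nf

/-- An entire function that vanishes at the origin and is real along a logarithmic spiral is
zero: its leading term turns along the spiral. -/
theorem eq_zero_of_real_on_spiral {a : ℝ} (ha : 0 < a) (θ₀ : ℝ) {F : ℂ → ℂ}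
    (hF : Differentiable ℂ F) (h0 : F 0 = 0) (hre : ∀ θ, (F (Z a θ₀ θ)).im = 0) (z : ℂ) :
    F z = 0 := by
  by_cases hz : ∀ᶠ z in 𝓝 (0 : ℂ), F z = 0
  · have hA : AnalyticOnNhd ℂ F Set.univ := fun z _ => hF.analyticAt z
    exact hA.eqOn_zero_of_preconnected_of_eventuallyEq_zero isPreconnected_univ
      (Set.mem_univ 0) hz (Set.mem_univ z)
  exfalso
  obtain ⟨n, G, hG, hG0, hFG⟩ := (hF.analyticAt 0).exists_eventuallyEq_pow_smul_nonzero_iff.2 hz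
  have hn : n ≠ 0 := by
    rintro rfl
    have := hFG.self_of_nhds
    simp [h0] at this
    exact hG0 this.symm
  have hn' : (n : ℝ) ≠ 0 := by exact_mod_cast hn
  have key : ∀ α : ℝ, (Complex.exp (α * Complex.I) * G 0).im = 0 := by
    intro α
    -- Chosen so that `n * t k` equals `α` modulo `2π` while `Z a θ₀ (t k)` tends to `0`.
    let t : ℕ → ℝ := fun k => α / n - k * (2 * Real.pi)
    have ht : Tendsto t atTop atBot := by
      refine tendsto_atBot_add_const_left _ (α / n) ?_
      exact tendsto_neg_atTop_atBot.comp
        (tendsto_natCast_atTop_atTop.atTop_mul_const Real.two_pi_pos)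
    have hZ : Tendsto (fun k => Z a θ₀ (t k)) atTop (𝓝 0) := by
      rw [tendsto_zero_iff_norm_tendsto_zero]
      have : ∀ k, ‖Z a θ₀ (t k)‖ = Real.exp (a * (t k - θ₀)) := by
        intro k
        rw [Z, norm_mul, Complex.norm_exp_ofReal_mul_I, mul_one, Complex.norm_real,
          Real.norm_of_nonneg (Real.exp_pos _).le]
      simp only [this]
      refine Real.tendsto_exp_atBot.comp (Tendsto.const_mul_atBot ha ?_)
      exact tendsto_atBot_add_const_right _ (-θ₀) ht
    have hlim : Tendsto (fun k => (Complex.exp (α * Complex.I) * G (Z a θ₀ (t k))).im) atTop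
        (𝓝 (Complex.exp (α * Complex.I) * G 0).im) :=
      (Complex.continuous_im.tendsto _).comp
        (tendsto_const_nhds.mul (hG.continuousAt.tendsto.comp hZ))
    refine tendsto_nhds_unique hlim (tendsto_const_nhds.congr' ?_)
    filter_upwards [hZ.eventually hFG] with k hk
    have h := hre (t k)
    have hexp : Complex.exp ((n * t k : ℝ) * Complex.I) = Complex.exp (α * Complex.I) := by
      rw [Complex.exp_eq_exp_iff_exists_int]
      refine ⟨-(n * k : ℤ), ?_⟩
      have : (n : ℂ) ≠ 0 := by exact_mod_cast hn
      simp only [t]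
      push_cast
      field_simp
      ring
    rw [hk, sub_zero, Z_pow, smul_eq_mul, mul_assoc, Complex.im_ofReal_mul, hexp] at h
    exact ((mul_eq_zero.1 h).resolve_left (by positivity)).symm
  -- The angles `0` and `π / 2` kill the imaginary and the real part of `G 0`.
  have k1 := key 0
  have k2 := key (Real.pi / 2)
  simp at k1
  push_cast at k2
  rw [Complex.exp_pi_div_two_mul_I] at k2
  simp at k2
  exact hG0 (Complex.ext k2 k1)

/-! ### Null sets and limits modulo null sets -/

/-- A logarithmic spiral is a Lebesgue null set. -/
theorem volume_spiral (a θ₀ : ℝ) : volume (spiral a θ₀) = 0 := by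
  -- The spiral is the image of the plane under `z ↦ Z a θ₀ z.re`, whose derivative `L z` kills `I`
  -- and so has determinant zero.
  let L : ℂ → ℂ →L[ℝ] ℂ := fun z =>
    (ContinuousLinearMap.toSpanSingleton ℝ (((a : ℂ) + Complex.I) * Z a θ₀ z.re)).comp
      Complex.reCLM
  have hL : ∀ z : ℂ, HasFDerivWithinAt (fun z : ℂ => Z a θ₀ z.re) (L z) Set.univ z := fun z =>
    ((hasDerivAt_Z a θ₀ z.re).hasFDerivAt.comp z Complex.reCLM.hasFDerivAt).hasFDerivWithinAt
  have hdet : ∀ z, (L z).det = 0 := by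
    intro z
    by_contra h
    have hinj : Function.Injective (L z) :=
      (LinearEquiv.ofIsUnitDet (f := (L z : ℂ →ₗ[ℝ] ℂ)) (v := Complex.basisOneI)
        (v' := Complex.basisOneI) (by
          rw [LinearMap.det_toMatrix]; exact isUnit_iff_ne_zero.2 h)).injective
    have : L z Complex.I = L z 0 := by simp [L]
    exact Complex.I_ne_zero (hinj this)
  have := addHaar_image_eq_zero_of_det_fderivWithin_eq_zero volume (s := Set.univ)
    (fun z _ => hL z) (fun z _ => hdet z)
  refine measure_mono_null ?_ this
  rintro _ ⟨θ, rfl⟩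
  exact ⟨θ, Set.mem_univ _, by simp⟩

theorem complementSet_mem_ae {M : ℕ} (a : ℝ) (θs : Fin M → ℝ) :
    complementSet a θs ∈ ae (volume : Measure ℂ) := by
  rw [mem_ae_iff, complementSet, compl_compl]
  exact measure_union_null (measure_iUnion_null fun m => volume_spiral a (θs m))
    (measure_singleton 0)

theorem offSpirals_eq {M : ℕ} (a : ℝ) (θs : Fin M → ℝ) (z : ℂ) :
    offSpirals a θs z = 𝓝 z ⊓ ae volume := by
  rw [offSpirals, nhdsWithin, inf_assoc,
    inf_eq_right.2 (le_principal_iff.2 (complementSet_mem_ae a θs))]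

/-- Neighbourhoods have positive measure, so they meet every conull set. This makes limits modulo
null sets unique. -/
instance neBot_nhds_inf_ae (z : ℂ) : (𝓝 z ⊓ ae (volume : Measure ℂ)).NeBot := by
  rw [inf_neBot_iff]
  intro s hs t ht
  by_contra hne
  have hsub : s ⊆ tᶜ := fun x hx hxt => hne ⟨x, hx, hxt⟩
  exact (Measure.measure_pos_of_mem_nhds volume hs).ne' (measure_mono_null hsub (mem_ae_iff.1 ht))

/-! ### Uniqueness -/

theorem IsSpiralVelocity.ae_eq {M : ℕ} (hM : 0 < M) {a μ : ℝ} (ha : 0 < a) {g θs : Fin M → ℝ}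
    {w₁ w₂ : ℂ → ℂ} (h₁ : IsSpiralVelocity a μ g θs w₁) (h₂ : IsSpiralVelocity a μ g θs w₂) :
    w₁ =ᵐ[volume] w₂ := by
  have hi : ∀ {w : ℂ → ℂ}, LocallyIntegrable w → ∀ {φ : ℂ → ℝ}, IsTestFunction φ → ∀ v,
      Integrable (fun z => (w z).re * fderiv ℝ φ z v) ∧
      Integrable (fun z => (w z).im * fderiv ℝ φ z v) := by
    intro w hw φ hφ v
    have hint : Integrable (fun z => fderiv ℝ φ z v • w z) := by
      refine hw.integrable_smul_left_of_hasCompactSupport ?_ ?_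
      · exact (hφ.1.continuous_fderiv (by simp)).clm_apply continuous_const
      · exact (hφ.2.fderiv (𝕜 := ℝ)).comp_left (g := fun L : ℂ →L[ℝ] ℝ => L v) (by simp)
    have hR := Complex.reCLM.integrable_comp hint
    have hI := Complex.imCLM.integrable_comp hint
    exact ⟨by simpa [mul_comm] using hR, by simpa [mul_comm] using hI⟩
  have hdiv : ∀ φ, IsTestFunction φ → distDiv (w₁ - w₂) φ = 0 := by
    intro φ hφ
    have e : distDiv (w₁ - w₂) φ = distDiv w₁ φ - distDiv w₂ φ := by
      simp only [distDiv, pdx, pdy]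
      rw [neg_sub_neg, ← integral_sub, ← integral_neg]
      · refine integral_congr_ae (Eventually.of_forall fun z => ?_)
        simp only [Pi.sub_apply, Complex.sub_re, Complex.sub_im]
        ring
      · exact (hi h₂.locallyIntegrable hφ _).1.add (hi h₂.locallyIntegrable hφ _).2
      · exact (hi h₁.locallyIntegrable hφ _).1.add (hi h₁.locallyIntegrable hφ _).2
    rw [e, h₁.div_eq φ hφ, h₂.div_eq φ hφ, sub_zero]
  have hcurl : ∀ φ, IsTestFunction φ → distCurl (w₁ - w₂) φ = 0 := by
    intro φ hφ
    have e : distCurl (w₁ - w₂) φ = distCurl w₁ φ - distCurl w₂ φ := by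
      simp only [distCurl, pdx, pdy]
      rw [neg_sub_neg, ← integral_sub, ← integral_neg]
      · refine integral_congr_ae (Eventually.of_forall fun z => ?_)
        simp only [Pi.sub_apply, Complex.sub_re, Complex.sub_im]
        ring
      · exact (hi h₂.locallyIntegrable hφ _).2.sub (hi h₂.locallyIntegrable hφ _).1
      · exact (hi h₁.locallyIntegrable hφ _).2.sub (hi h₁.locallyIntegrable hφ _).1
    rw [e, h₁.curl_eq φ hφ, h₂.curl_eq φ hφ, sub_self]
  obtain ⟨h, hh, hae⟩ := exists_entire_ae_eq_conj
    (h₁.locallyIntegrable.sub h₂.locallyIntegrable) hdiv hcurl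
  let m : Fin M := ⟨0, hM⟩
  have hnormal : ∀ θ, inner ℝ (normal a (θs m) θ)
      ((starRingEnd ℂ) (h (Z a (θs m) θ))) = 0 := by
    intro θ
    have l1 := h₁.velocity_matching m θ
    have l2 := h₂.velocity_matching m θ
    rw [offSpirals_eq] at l1 l2
    have l := l1.sub l2
    rw [sub_zero] at l
    have hc : Continuous fun z => inner ℝ (normal a (θs m) θ) ((starRingEnd ℂ) (h z)) :=
      continuous_const.inner (Complex.continuous_conj.comp hh.continuous)
    refine tendsto_nhds_unique ((hc.tendsto _).mono_left inf_le_left) (l.congr' ?_)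
    filter_upwards [hae.filter_mono inf_le_right] with z hz
    rw [← inner_sub_right, ← hz]
    simp
  -- With `d = (a + i) Z` the normal is `-i d / ‖d‖`, and its scalar product with `conj h` is `Im (d
  -- h) / ‖d‖`. The factor `z` makes the function vanish at `0`.
  have hzero : ∀ z, ((a : ℂ) + Complex.I) * z * h z = 0 := by
    refine eq_zero_of_real_on_spiral ha (θs m) (by fun_prop) (by simp) fun θ => ?_
    have hn := hnormal θ
    rw [normal, tangent, (hasDerivAt_Z a (θs m) θ).deriv] at hn
    set d := ((a : ℂ) + Complex.I) * Z a (θs m) θ with hd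
    have hd0 : ‖d‖ ≠ 0 := by
      rw [norm_ne_zero_iff, hd]
      refine mul_ne_zero (fun hc => ?_) ?_
      · simpa using congrArg Complex.im hc
      · simp [Z]
    have e : inner ℝ (-Complex.I * (d / (‖d‖ : ℂ))) ((starRingEnd ℂ) (h (Z a (θs m) θ))) =
        (d * h (Z a (θs m) θ)).im / ‖d‖ := by
      rw [div_eq_mul_inv d, ← Complex.ofReal_inv, Complex.inner]
      simp
      ring
    rw [e] at hn
    exact (div_eq_zero_iff.1 hn).resolve_right hd0
  have hh0 : h = 0 := by
    have hne : ∀ z : ℂ, z ≠ 0 → h z = 0 := by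
      intro z hz
      have h2 : ((a : ℂ) + Complex.I) ≠ 0 := fun hc => by
        simpa using congrArg Complex.im hc
      simpa [h2, hz] using hzero z
    refine hh.continuous.ext_on (dense_compl_singleton (0 : ℂ)) continuous_const ?_
    exact fun z hz => hne z hz
  filter_upwards [hae] with z hz
  simpa [hh0, sub_eq_zero] using hz

/-- Fields that agree almost everywhere and are continuous off the spirals agree there. -/
theorem eqOn_complementSet_of_ae_eq {M : ℕ} (a : ℝ) (θs : Fin M → ℝ) {w₁ w₂ : ℂ → ℂ}
    (h : w₁ =ᵐ[volume] w₂) (h₁ : ContinuousOn w₁ (complementSet a θs))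
    (h₂ : ContinuousOn w₂ (complementSet a θs)) : Set.EqOn w₁ w₂ (complementSet a θs) := by
  intro z hz
  have hle : 𝓝 z ⊓ ae volume ≤ 𝓝[complementSet a θs] z :=
    (offSpirals_eq a θs z).symm.le.trans inf_le_left
  exact tendsto_nhds_unique_of_eventuallyEq ((h₁ z hz).mono_left hle)
    ((h₂ z hz).mono_left hle) (h.filter_mono inf_le_right)

end LogSpirals

theorem theorem6p2 (M : ℕ) (hM : 2 ≤ M) (a μ : ℝ) (ha : 0 < a) (g θs : Fin M → ℝ)
    (hg : ∀ m, g m ≠ 0) (hθ : ∀ m, θs m ∈ Set.Ico 0 (2 * Real.pi))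
    (hinj : Function.Injective θs) (w₁ w₂ : ℂ → ℂ)
    (h₁ : LogSpirals.IsSpiralVelocity a μ g θs w₁)
    (h₂ : LogSpirals.IsSpiralVelocity a μ g θs w₂) :
    w₁ =ᵐ[MeasureTheory.volume] w₂ ∧
      (ContinuousOn w₁ (LogSpirals.complementSet a θs) →
        ContinuousOn w₂ (LogSpirals.complementSet a θs) →
          Set.EqOn w₁ w₂ (LogSpirals.complementSet a θs)) := by
  have h := h₁.ae_eq (by omega) ha h₂
  exact ⟨h, LogSpirals.eqOn_complementSet_of_ae_eq a θs h⟩
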